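/- Let $m,n,k$ be positive integers with $1\le k\le \min\{m,n\}$, and let $|v\rangle\in\mathbb{C}^m\otimes\mathbb{C}^n$ be a pure state, i.e. a unit vector. Write its Schmidt decomposition as $|v\rangle=\sum_{i=1}^{\min\{m,n\}}\alpha_i\,|a_i\rangle\otimes|b_i\rangle$ with $\{|a_i\rangle\}\subset\mathbb{C}^m$ and $\{|b_i\rangle\}\subset\mathbb{C}^n$ orthonormal and Schmidt coefficients $\alpha_1\ge\alpha_2\ge\cdots\ge\alpha_{\min\{m,n\}}\ge 0$. The Schmidt rank $SR(|u\rangle)$ of a pure state $|u\rangle$ is the least number of product states $|a\rangle\otimes|b\rangle$ (with $|a\rangle$, $|b\rangle$ unit vectors) of which $|u\rangle$ is a linear combination. For an operator $X$ on $\mathbb{C}^m\otimes\mathbb{C}^n$ define $$\|X\|_{\gamma,k}:=\inf\Big\{\sum_i|c_i| \;:\; X=\sum_i c_i\,|v_i\rangle\langle w_i|,\ c_i\in\mathbb{C},\ |v_i\rangle,|w_i\rangle \text{ unit vectors with } SR(|v_i\rangle),SR(|w_i\rangle)\le k \text{ for all } i\Big\},$$ where the infimum is over all finite decompositions of this form.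 Let $r$ be the largest index $1\le r<k$ such that $$\alpha_r>\frac{1}{k-r}\sum_{i=r+1}^{\min\{m,n\}}\alpha_i,$$ with $r=0$ if no such index exists, and let $\tilde\alpha:=\frac{1}{k-r}\sum_{i=r+1}^{\min\{m,n\}}\alpha_i$. Then $$\big\|\,|v\rangle\langle v|\,\big\|_{\gamma,k}=\sum_{i=1}^{r}\alpha_i^2+(k-r)\,\tilde\alpha^2 .$$ -/

import Mathlib

open scoped TensorProduct InnerProductSpace

namespace EntanglementNorm

noncomputable section

/-- The bipartite Hilbert space `ℂ^m ⊗ ℂ^n` with its natural inner product,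
`⟪a ⊗ b, c ⊗ d⟫ = ⟪a, c⟫ * ⟪b, d⟫`. -/
abbrev Bipartite (m n : ℕ) : Type :=
  EuclideanSpace ℂ (Fin m) ⊗[ℂ] EuclideanSpace ℂ (Fin n)

/-- The operator `|v⟩⟨w|`, that is `z ↦ ⟪w, z⟫ • v`. -/
abbrev ketbra {m n : ℕ} (v w : Bipartite m n) : Bipartite m n →L[ℂ] Bipartite m n :=
  InnerProductSpace.rankOne ℂ v w

/-- A separable pure state: `|a⟩ ⊗ |b⟩` with unit vectors `|a⟩` and `|b⟩`. -/
def IsSeparable {m n : ℕ} (v : Bipartite m n) : Prop :=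
  ∃ (a : EuclideanSpace ℂ (Fin m)) (b : EuclideanSpace ℂ (Fin n)),
    ‖a‖ = 1 ∧ ‖b‖ = 1 ∧ v = a ⊗ₜ[ℂ] b

/-- The Schmidt rank: the least `k` such that `v` is a linear combination of `k` separable
pure states. -/
def schmidtRank {m n : ℕ} (v : Bipartite m n) : ℕ :=
  sInf {k : ℕ | ∃ (c : Fin k → ℂ) (u : Fin k → Bipartite m n),
    (∀ i, IsSeparable (u i)) ∧ v = ∑ i, c i • u i}

/-- The norm `‖X‖_{γ,k}`: the infimum of `∑ i, |c i|` over all finite decompositions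
`X = ∑ i, c i • |v i⟩⟨w i|` into pure states `v i`, `w i` of Schmidt rank at most `k`. -/
def gammaNorm {m n : ℕ} (k : ℕ) (X : Bipartite m n →L[ℂ] Bipartite m n) : ℝ :=
  sInf {s : ℝ | ∃ (N : ℕ) (c : Fin N → ℂ) (v w : Fin N → Bipartite m n),
    (∀ i, ‖v i‖ = 1 ∧ schmidtRank (v i) ≤ k) ∧
    (∀ i, ‖w i‖ = 1 ∧ schmidtRank (w i) ≤ k) ∧
    X = ∑ i, c i • ketbra (v i) (w i) ∧
    s = ∑ i, ‖c i‖}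

/-- `α 1 ≥ α 2 ≥ ⋯ ≥ α (min m n) ≥ 0` are the Schmidt coefficients of `v`, padded with zeros up
to the index `min m n`. The values of `α` at other indices are irrelevant. -/
def IsSchmidtCoefficients {m n : ℕ} (v : Bipartite m n) (α : ℕ → ℝ) : Prop :=
  AntitoneOn α (Set.Icc 1 (min m n)) ∧
  (∀ i ∈ Set.Icc 1 (min m n), 0 ≤ α i) ∧
  ∃ (a : Fin (min m n) → EuclideanSpace ℂ (Fin m))
    (b : Fin (min m n) → EuclideanSpace ℂ (Fin n)),
    Orthonormal ℂ a ∧ Orthonormal ℂ b ∧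
    v = ∑ i : Fin (min m n), (α (i.val + 1) : ℂ) • (a i ⊗ₜ[ℂ] b i)

/-- The quantity `(∑_{i = r + 1}^{d} α i) / (k - r)`. -/
def tailMean (d k : ℕ) (α : ℕ → ℝ) (r : ℕ) : ℝ :=
  (∑ i ∈ Finset.Icc (r + 1) d, α i) / ((k : ℝ) - (r : ℝ))

/-- The largest index `1 ≤ r < k` with `α r > (∑_{i = r + 1}^{d} α i) / (k - r)`, and `0` if there
is no such index (the supremum of the empty set of natural numbers is `0`). -/
def cutIndex (d k : ℕ) (α : ℕ → ℝ) : ℕ :=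
  sSup {r : ℕ | 1 ≤ r ∧ r < k ∧ tailMean d k α r < α r}

end

/-- Every vector has a Schmidt decomposition. -/
theorem exists_isSchmidtCoefficients {m n : ℕ} (v : Bipartite m n) :
    ∃ α : ℕ → ℝ, IsSchmidtCoefficients v α := by
  classical
  let e := EuclideanSpace.basisFun (Fin n) ℂ
  obtain ⟨x, hx⟩ : ∃ x : Fin n → EuclideanSpace ℂ (Fin m), v = ∑ j, x j ⊗ₜ[ℂ] e j := by
    induction v using TensorProduct.induction_on with
    | zero => exact ⟨0, by simp⟩
    | tmul a b =>
      refine ⟨fun j => ⟪e j, b⟫_ℂ • a, ?_⟩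
      simp_rw [TensorProduct.smul_tmul, ← TensorProduct.tmul_sum]
      rw [e.sum_repr' b]
    | add y z hy hz =>
      obtain ⟨x, rfl⟩ := hy
      obtain ⟨x', rfl⟩ := hz
      exact ⟨x + x', by simp [TensorProduct.add_tmul, Finset.sum_add_distrib]⟩
  let T : EuclideanSpace ℂ (Fin n) →ₗ[ℂ] EuclideanSpace ℂ (Fin m) := e.toBasis.constr ℂ x
  have hT : ∀ j, T (e j) = x j := fun j => by
    have h := e.toBasis.constr_basis ℂ x j
    rwa [e.coe_toBasis] at h
  have hn : Module.finrank ℂ (EuclideanSpace ℂ (Fin n)) = n := by simp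
  let f := T.isSymmetric_adjoint_comp_self.eigenvectorBasis hn
  have hTf : ∀ i j, ⟪T (f i), T (f j)⟫_ℂ = if i = j then ((T.singularValues j : ℝ) : ℂ) ^ 2 else 0 := by
    intro i j
    rw [← LinearMap.adjoint_inner_right, ← LinearMap.comp_apply,
      T.isSymmetric_adjoint_comp_self.apply_eigenvectorBasis hn j, inner_smul_right,
      ← T.sq_singularValues_fin hn j]
    change _ * ⟪f i, f j⟫_ℂ = _
    rw [f.inner_eq_ite]
    split_ifs <;> simp
  let g : Fin n → EuclideanSpace ℂ (Fin n) := fun l => ∑ j, ⟪f l, e j⟫_ℂ • e j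
  have hg : Orthonormal ℂ g := by
    rw [orthonormal_iff_ite]
    intro i j
    have h : ⟪g i, g j⟫_ℂ = ⟪f j, f i⟫_ℂ := by
      rw [← e.sum_inner_mul_inner (f j) (f i), e.orthonormal.inner_sum]
      refine Finset.sum_congr rfl fun l _ => ?_
      rw [inner_conj_symm, mul_comm]
    rw [h, f.inner_eq_ite]
    simp [eq_comm]
  have hv : v = ∑ l, T (f l) ⊗ₜ[ℂ] g l := by
    rw [hx]
    have h1 : ∀ j, x j = ∑ l, ⟪f l, e j⟫_ℂ • T (f l) := fun j => by
      rw [← hT j]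
      conv_lhs => rw [← f.sum_repr' (e j)]
      simp
    simp_rw [h1, TensorProduct.sum_tmul, g, TensorProduct.tmul_sum, TensorProduct.smul_tmul]
    exact Finset.sum_comm
  have hσ0 : ∀ i, n ≤ i → T.singularValues i = 0 := fun i hi =>
    T.singularValues_of_finrank_le (by simpa using hi)
  have hσm : ∀ i, m ≤ i → T.singularValues i = 0 := fun i hi => by
    rw [← Finsupp.notMem_support_iff, T.support_singularValues]
    have : Module.finrank ℂ (LinearMap.range T) ≤ m := by
      simpa using Submodule.finrank_le (LinearMap.range T)
    simp
    omega
  let a' : Fin m → EuclideanSpace ℂ (Fin m) := fun i =>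
    if h : i.val < n then ((T.singularValues i : ℝ) : ℂ)⁻¹ • T (f ⟨i, h⟩) else 0
  let s : Set (Fin m) := {i | T.singularValues i ≠ 0}
  have hs : ∀ i ∈ s, i.val < n := fun i hi => by
    by_contra h
    exact hi (hσ0 i (by omega))
  have ha' : Orthonormal ℂ (s.domRestrict a') := by
    rw [orthonormal_iff_ite]
    rintro ⟨i, hi⟩ ⟨j, hj⟩
    have hi0 : ((T.singularValues i : ℝ) : ℂ) ≠ 0 := by exact_mod_cast hi
    have hj0 : ((T.singularValues j : ℝ) : ℂ) ≠ 0 := by exact_mod_cast hj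
    simp only [Set.domRestrict_apply, a', hs i hi, hs j hj, dif_pos, inner_smul_left,
      inner_smul_right, hTf, Subtype.mk.injEq, Fin.ext_iff]
    split_ifs with h
    · have : i = j := Fin.ext h
      subst this
      simp
      field_simp
    · simp
  obtain ⟨A, hA⟩ := ha'.exists_orthonormalBasis_extension_of_card_eq (by simp)
  have hTA : ∀ (j : ℕ) (h1 : j < n) (h2 : j < m),
      T (f ⟨j, h1⟩) = ((T.singularValues j : ℝ) : ℂ) • A ⟨j, h2⟩ := by
    intro j h1 h2
    by_cases h : T.singularValues j = 0
    · have h3 := hTf ⟨j, h1⟩ ⟨j, h1⟩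
      simp [h] at h3
      simp [h, h3]
    · rw [hA ⟨j, h2⟩ h]
      simp [a', h1, smul_smul, h]
  have hT0 : ∀ j : Fin n, m ≤ j.val → T (f j) = 0 := by
    intro j hj
    have h3 := hTf j j
    simpa [hσm j hj] using h3
  refine ⟨fun i => T.singularValues (i - 1), ?_, fun i _ => T.singularValues_nonneg _,
    fun i => A (Fin.castLE (min_le_left m n) i), fun i => g (Fin.castLE (min_le_right m n) i),
    A.orthonormal.comp _ (Fin.castLE_injective _), hg.comp _ (Fin.castLE_injective _), ?_⟩
  · intro i _ j _ hij
    exact T.singularValues_antitone (Nat.sub_le_sub_right hij 1)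
  · rw [hv]
    symm
    refine Finset.sum_of_injOn (Fin.castLE (min_le_right m n))
      (Fin.castLE_injective _).injOn (by simp) ?_ ?_
    · intro j _ hj
      rw [hT0 j, TensorProduct.zero_tmul]
      by_contra h
      exact hj ⟨⟨j, by omega⟩, by simp, rfl⟩
    · intro i _
      have := hTA i (by omega) (by omega)
      rw [show Fin.castLE (min_le_right m n) i = ⟨i, by omega⟩ from rfl, this,
        TensorProduct.smul_tmul']
      simp
      rfl

/-- The infimum that defines the Schmidt rank is attained. -/
theorem schmidtRank_spec {m n : ℕ} (v : Bipartite m n) :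
    ∃ (c : Fin (schmidtRank v) → ℂ) (u : Fin (schmidtRank v) → Bipartite m n),
      (∀ i, IsSeparable (u i)) ∧ v = ∑ i, c i • u i := by
  obtain ⟨α, -, -, a, b, ha, hb, h⟩ := exists_isSchmidtCoefficients v
  exact Nat.sInf_mem (s := {k : ℕ | ∃ (c : Fin k → ℂ) (u : Fin k → Bipartite m n),
    (∀ i, IsSeparable (u i)) ∧ v = ∑ i, c i • u i})
    ⟨min m n, fun i => (α (i.val + 1) : ℂ), fun i => a i ⊗ₜ[ℂ] b i,
      fun i => ⟨a i, b i, ha.1 i, hb.1 i, rfl⟩, h⟩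

end EntanglementNorm

namespace EntanglementNorm

/-! Flatten the Schmidt coefficients: keep `α i` for `i ≤ r` and replace every later one by `αt`.
The choice of `r` makes the result `β` antitone and at least `α`, so `α = β * p` for weights `p` in
`[0, 1]`; they can be chosen with total mass `k`, because the tail of `α` sums to `(k - r) * αt`.
The claimed value is then `M`, the sum of the `k` largest `β i ^ 2`, and it equals `∑ β i ^ 2 * p
i`.

Upper bound: `p` is a convex combination of indicators of `k`-element sets `S`
(`exists_perm_weights`, from Birkhoff's theorem). So `v` is the same combination of the vectors `∑ i
∈ S, β i • (a i ⊗ b i)`, which have Schmidt rank at most `k` and squared norm at most `M`;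
`gammaNorm_ketbra_self_le` concludes.

Lower bound: the witness `w = ∑ β i • (a i ⊗ b i)` has squared overlap at most `M` with unit vectors
of Schmidt rank at most `k` (`norm_inner_sq_le`), while `⟪w, v⟫ = M`. Evaluating a decomposition of
`|v⟩⟨v|` at `w` gives `M ^ 2 ≤ M * ∑ |c i|`. -/

open Finset

/-! ### Rearrangement and convex combinations of `k`-subsets -/

/-- A weighted sum of an antitone sequence with weights in `[0, 1]` of total mass at most `k` is
at most the sum of the `k` leading terms. -/
theorem sum_mul_le_sum_filter_lt {d k : ℕ} (hk : 1 ≤ k) (hkd : k ≤ d) {f p : Fin d → ℝ}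
    (hf : Antitone f) (hf0 : ∀ i, 0 ≤ f i) (hp0 : ∀ i, 0 ≤ p i) (hp1 : ∀ i, p i ≤ 1)
    (hp : ∑ i, p i ≤ k) :
    ∑ i, f i * p i ≤ ∑ i with i.val < k, f i := by
  -- With `f t`, the last counted value, as threshold, `f i - f t` and `p i - q i` never have the
  -- same strict sign.
  let t : Fin d := ⟨k - 1, by omega⟩
  let q : Fin d → ℝ := fun i => if i.val < k then 1 else 0
  have hq : ∑ i, q i = k := by
    simp [q, Finset.sum_boole, Fin.card_filter_val_lt, hkd]
  have h1 : ∀ i, (f i - f t) * (p i - q i) ≤ 0 := by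
    intro i
    by_cases h : i.val < k
    · have h2 : f t ≤ f i := hf (Fin.mk_le_mk.2 (by omega) : i ≤ t)
      have := hp1 i
      simp only [q, h, if_true]
      exact mul_nonpos_of_nonneg_of_nonpos (by linarith) (by linarith)
    · have h2 : f i ≤ f t := hf (Fin.mk_le_mk.2 (by omega) : t ≤ i)
      have := hp0 i
      simp only [q, h, if_false]
      exact mul_nonpos_of_nonpos_of_nonneg (by linarith) (by linarith)
  have h2 : ∑ i, (f i - f t) * (p i - q i)
      = ∑ i, f i * p i - ∑ i, f i * q i - f t * (∑ i, p i - ∑ i, q i) := by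
    simp only [Finset.mul_sum, ← Finset.sum_sub_distrib]
    exact Finset.sum_congr rfl fun i _ => by ring
  have h3 : ∑ i, f i * q i = ∑ i with i.val < k, f i := by
    simp [q, Finset.sum_filter]
  have h4 := Finset.sum_nonpos fun i (_ : i ∈ Finset.univ) => h1 i
  have h5 : f t * (∑ i, p i - ∑ i, q i) ≤ 0 :=
    mul_nonpos_of_nonneg_of_nonpos (hf0 t) (by linarith)
  linarith

/-- A vector with entries in `[0, 1]` and integral total mass `#T` is a convex combination of the
indicator vectors of the preimages of `T` under permutations. -/
theorem exists_perm_weights {ι : Type*} [Fintype ι] [DecidableEq ι] (T : Finset ι) (p : ι → ℝ)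
    (hp0 : ∀ i, 0 ≤ p i) (hp1 : ∀ i, p i ≤ 1) (hp : ∑ i, p i = #T) :
    ∃ w : Equiv.Perm ι → ℝ, (∀ σ, 0 ≤ w σ) ∧ ∑ σ, w σ = 1 ∧
      ∀ i, p i = ∑ σ, w σ * if σ i ∈ T then 1 else 0 := by
  have hpc : ∑ i, (1 - p i) = #Tᶜ := by
    have h : (#T + #Tᶜ : ℝ) = Fintype.card ι := by exact_mod_cast Finset.card_add_card_compl T
    rw [Finset.sum_sub_distrib, hp, Finset.sum_const, Finset.card_univ, nsmul_one, ← h]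
    ring
  -- Division by `#T = 0` is harmless: the total mass is then zero, so every `p i` vanishes. The
  -- complement is treated likewise.
  have h1 : ∀ i, (#T : ℝ) * (p i / #T) = p i := fun i => by
    refine mul_div_cancel_of_imp' fun h => ?_
    rw [h] at hp
    exact (Finset.sum_eq_zero_iff_of_nonneg fun i _ => hp0 i).1 hp i (Finset.mem_univ i)
  have h2 : ∀ i, (#Tᶜ : ℝ) * ((1 - p i) / #Tᶜ) = 1 - p i := fun i => by
    refine mul_div_cancel_of_imp' fun h => ?_
    rw [h] at hpc
    exact (Finset.sum_eq_zero_iff_of_nonneg fun i _ => sub_nonneg.2 (hp1 i)).1 hpc i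
      (Finset.mem_univ i)
  -- Row `i` spreads `p i` evenly over the columns in `T` and `1 - p i` over the others, so its
  -- entries in `T` sum to `p i`. Birkhoff's theorem then supplies the permutations.
  let M : Matrix ι ι ℝ := fun i j => if j ∈ T then p i / #T else (1 - p i) / #Tᶜ
  have hM : M ∈ doublyStochastic ℝ ι := by
    rw [mem_doublyStochastic_iff_sum]
    refine ⟨fun i j => ?_, fun i => ?_, fun j => ?_⟩
    · have := hp0 i
      have := sub_nonneg.2 (hp1 i)
      simp only [M]
      split_ifs <;> positivity
    · rw [← Finset.sum_add_sum_compl T,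
        Finset.sum_congr rfl fun j hj => show M i j = p i / #T from if_pos hj,
        Finset.sum_congr rfl fun j hj => show M i j = (1 - p i) / #Tᶜ from
          if_neg (Finset.mem_compl.1 hj)]
      simp only [Finset.sum_const, nsmul_eq_mul, h1, h2]
      ring
    · by_cases hj : j ∈ T
      · have : (#T : ℝ) ≠ 0 := by exact_mod_cast (Finset.card_pos.2 ⟨j, hj⟩).ne'
        simp only [M, hj, if_true, ← Finset.sum_div, hp]
        exact div_self this
      · have : (#Tᶜ : ℝ) ≠ 0 := by
          exact_mod_cast (Finset.card_pos.2 ⟨j, Finset.mem_compl.2 hj⟩).ne'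
        simp only [M, hj, if_false, ← Finset.sum_div, hpc]
        exact div_self this
  obtain ⟨w, hw0, hw1, hw⟩ := exists_eq_sum_perm_of_mem_doublyStochastic hM
  refine ⟨w, hw0, hw1, fun i => ?_⟩
  have h3 : ∑ j ∈ T, M i j = p i := by
    rw [Finset.sum_congr rfl fun j hj => show M i j = p i / #T from if_pos hj]
    simp only [Finset.sum_const, nsmul_eq_mul, h1]
  rw [← h3, ← hw]
  simp only [Matrix.sum_apply, Matrix.smul_apply, smul_eq_mul]
  rw [Finset.sum_comm]
  refine Finset.sum_congr rfl fun σ _ => ?_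
  rw [← Finset.mul_sum]
  congr 1
  simp [PEquiv.toMatrix_apply]

/-! ### Upper bounds from decompositions -/

theorem schmidtRank_sum_le {m n : ℕ} {ι : Type*} (s : Finset ι) (c : ι → ℂ)
    (u : ι → Bipartite m n) (hu : ∀ i, IsSeparable (u i)) :
    schmidtRank (∑ i ∈ s, c i • u i) ≤ #s := by
  refine Nat.sInf_le ⟨fun j => c (s.equivFin.symm j), fun j => u (s.equivFin.symm j),
    fun j => hu _, ?_⟩
  rw [s.equivFin.symm.sum_comp (fun i : s => c i • u i), Finset.sum_coe_sort s fun i => c i • u i]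

theorem schmidtRank_smul_le {m n : ℕ} (z : ℂ) (v : Bipartite m n) :
    schmidtRank (z • v) ≤ schmidtRank v := by
  obtain ⟨c, u, hu, hv⟩ := schmidtRank_spec v
  refine Nat.sInf_le ⟨fun i => z * c i, u, hu, ?_⟩
  conv_lhs => rw [hv]
  simp [Finset.smul_sum, mul_smul]

theorem exists_normalization {m n k : ℕ} (hm : 0 < m) (hn : 0 < n) (hk : 1 ≤ k)
    (x : Bipartite m n) (hx : schmidtRank x ≤ k) :
    ∃ u : Bipartite m n, (‖u‖ = 1 ∧ schmidtRank u ≤ k) ∧ x = (‖x‖ : ℂ) • u := by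
  by_cases h : x = 0
  -- The zero vector has no direction, so any product unit vector serves; this is where `m`, `n` and
  -- `k` must be positive.
  · let e := EuclideanSpace.basisFun (Fin m) ℂ ⟨0, hm⟩
    let f := EuclideanSpace.basisFun (Fin n) ℂ ⟨0, hn⟩
    have he : ‖e‖ = 1 := (EuclideanSpace.basisFun (Fin m) ℂ).orthonormal.1 _
    have hf : ‖f‖ = 1 := (EuclideanSpace.basisFun (Fin n) ℂ).orthonormal.1 _
    refine ⟨e ⊗ₜ[ℂ] f, ⟨by simp [he, hf], ?_⟩, by simp [h]⟩
    have := schmidtRank_sum_le {()} (fun _ => 1) (fun _ => e ⊗ₜ[ℂ] f)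
      (fun _ => ⟨e, f, he, hf, rfl⟩)
    simp only [Finset.sum_singleton, one_smul, Finset.card_singleton] at this
    exact this.trans hk
  · have h0 : (‖x‖ : ℂ) ≠ 0 := by simpa using h
    refine ⟨(‖x‖ : ℂ)⁻¹ • x, ⟨?_, (schmidtRank_smul_le _ _).trans hx⟩, ?_⟩
    · simp [norm_smul, h]
    · rw [smul_smul, mul_inv_cancel₀ h0, one_smul]

theorem gammaNorm_le {m n k : ℕ} {ι : Type*} [Fintype ι] {X : Bipartite m n →L[ℂ] Bipartite m n}
    (c : ι → ℂ) (v w : ι → Bipartite m n) (hv : ∀ i, ‖v i‖ = 1 ∧ schmidtRank (v i) ≤ k)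
    (hw : ∀ i, ‖w i‖ = 1 ∧ schmidtRank (w i) ≤ k) (hX : X = ∑ i, c i • ketbra (v i) (w i)) :
    gammaNorm k X ≤ ∑ i, ‖c i‖ := by
  let e := (Fintype.equivFin ι).symm
  refine csInf_le ⟨0, ?_⟩ ⟨Fintype.card ι, c ∘ e, v ∘ e, w ∘ e, fun i => hv _, fun i => hw _, ?_, ?_⟩
  · rintro s ⟨N, c, v, w, -, -, -, rfl⟩
    positivity
  · rw [hX]
    exact (e.sum_comp fun i => c i • ketbra (v i) (w i)).symm
  · exact (e.sum_comp fun i => ‖c i‖).symm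

theorem rankOne_sum_smul_self {E ι : Type*} [NormedAddCommGroup E] [InnerProductSpace ℂ E]
    [Fintype ι] (c : ι → ℝ) (u : ι → E) :
    InnerProductSpace.rankOne ℂ (∑ i, (c i : ℂ) • u i) (∑ i, (c i : ℂ) • u i)
      = ∑ q : ι × ι, ((c q.1 * c q.2 : ℝ) : ℂ) • InnerProductSpace.rankOne ℂ (u q.1) (u q.2) := by
  ext z
  simp only [InnerProductSpace.rankOne_apply, _root_.sum_apply, _root_.smul_apply, sum_inner,
    inner_smul_left, Complex.conj_ofReal, Finset.sum_smul_sum, smul_smul,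
    Fintype.sum_prod_type, Complex.ofReal_mul]
  rw [Finset.sum_comm]
  refine Finset.sum_congr rfl fun i _ => Finset.sum_congr rfl fun j _ => ?_
  congr 1
  ring

theorem inner_sum_rankOne_apply {E ι : Type*} [NormedAddCommGroup E] [InnerProductSpace ℂ E]
    [Fintype ι] (c : ι → ℂ) (x y : ι → E) (w : E) :
    ⟪w, (∑ i, c i • InnerProductSpace.rankOne ℂ (x i) (y i)) w⟫_ℂ
      = ∑ i, c i * (⟪w, x i⟫_ℂ * ⟪y i, w⟫_ℂ) := by
  simp only [_root_.sum_apply, _root_.smul_apply, inner_sum, inner_smul_right,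
    InnerProductSpace.inner_right_rankOne_apply]

/-- Expanding both sides of `|v⟩⟨v|` over the normalized `x i` yields a decomposition of cost `(∑ w
i * ‖x i‖) ^ 2`, and a weighted mean of norms is at most `√M`. -/
theorem gammaNorm_ketbra_self_le {m n k : ℕ} {ι : Type*} [Fintype ι] (hm : 0 < m) (hn : 0 < n)
    (hk : 1 ≤ k) {M : ℝ} (w : ι → ℝ) (hw0 : ∀ i, 0 ≤ w i) (hw1 : ∑ i, w i = 1)
    (x : ι → Bipartite m n) (hx : ∀ i, schmidtRank (x i) ≤ k) (hxM : ∀ i, ‖x i‖ ^ 2 ≤ M)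
    {v : Bipartite m n} (hv : v = ∑ i, (w i : ℂ) • x i) :
    gammaNorm k (ketbra v v) ≤ M := by
  choose u hu hxu using fun i => exists_normalization hm hn hk (x i) (hx i)
  have h : ketbra v v = ∑ q : ι × ι, ((w q.1 * ‖x q.1‖ * (w q.2 * ‖x q.2‖) : ℝ) : ℂ) •
      ketbra (u q.1) (u q.2) := by
    have hv' : v = ∑ i, ((w i * ‖x i‖ : ℝ) : ℂ) • u i := by
      rw [hv]
      refine Finset.sum_congr rfl fun i _ => ?_
      conv_lhs => rw [hxu i]
      rw [smul_smul]
      push_cast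
      rfl
    conv_lhs => rw [hv']
    exact rankOne_sum_smul_self _ _
  refine (gammaNorm_le _ _ _ (fun q => hu q.1) (fun q => hu q.2) h).trans ?_
  have h2 : ∑ q : ι × ι, ‖((w q.1 * ‖x q.1‖ * (w q.2 * ‖x q.2‖) : ℝ) : ℂ)‖
      = (∑ i, w i * ‖x i‖) ^ 2 := by
    rw [Fintype.sum_prod_type, sq, Finset.sum_mul_sum]
    refine Finset.sum_congr rfl fun i _ => Finset.sum_congr rfl fun j _ => ?_
    have := hw0 i
    have := hw0 j
    rw [Complex.norm_real, Real.norm_of_nonneg (by positivity)]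
  rw [h2]
  obtain ⟨i₀⟩ : Nonempty ι := by
    by_contra hne
    rw [not_nonempty_iff] at hne
    simp at hw1
  have hM : 0 ≤ M := (sq_nonneg _).trans (hxM i₀)
  have h3 : ∑ i, w i * ‖x i‖ ≤ √M := by
    calc ∑ i, w i * ‖x i‖ ≤ ∑ i, w i * √M :=
          Finset.sum_le_sum fun i _ => mul_le_mul_of_nonneg_left (Real.le_sqrt_of_sq_le (hxM i)) (hw0 i)
      _ = √M := by rw [← Finset.sum_mul, hw1, one_mul]
  have h4 : 0 ≤ ∑ i, w i * ‖x i‖ := Finset.sum_nonneg fun i _ => mul_nonneg (hw0 i) (norm_nonneg _)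
  calc _ ≤ √M ^ 2 := pow_le_pow_left₀ h4 h3 2
    _ = M := Real.sq_sqrt hM

/-! ### Overlaps with vectors of bounded Schmidt rank -/

theorem orthonormal_tmul {m n : ℕ} {ι : Type*} {a : ι → EuclideanSpace ℂ (Fin m)}
    {b : ι → EuclideanSpace ℂ (Fin n)} (ha : Orthonormal ℂ a) (hb : Orthonormal ℂ b) :
    Orthonormal ℂ fun i => a i ⊗ₜ[ℂ] b i := by
  classical
  rw [orthonormal_iff_ite] at *
  intro i j
  rw [TensorProduct.inner_tmul, ha, hb]
  split_ifs <;> simp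

theorem norm_sum_smul_sq {E ι : Type*} [NormedAddCommGroup E] [InnerProductSpace ℂ E] {e : ι → E}
    (he : Orthonormal ℂ e) (s : Finset ι) (c : ι → ℝ) :
    ‖∑ i ∈ s, (c i : ℂ) • e i‖ ^ 2 = ∑ i ∈ s, c i ^ 2 := by
  have h := he.inner_sum (fun i => (c i : ℂ)) (fun i => (c i : ℂ)) s
  rw [inner_self_eq_norm_sq_to_K] at h
  apply Complex.ofReal_injective
  push_cast
  refine (show _ = _ from h).trans (Finset.sum_congr rfl fun i _ => ?_)
  simp [sq]

/-- A vector of Schmidt rank at most `k` is supported on an at most `k`-dimensional subspace of the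
first tensor factor. -/
theorem exists_eq_sum_orthonormal_tmul {m n : ℕ} (u : Bipartite m n) :
    ∃ (s : ℕ) (e : Fin s → EuclideanSpace ℂ (Fin m)) (z : Fin s → EuclideanSpace ℂ (Fin n)),
      s ≤ schmidtRank u ∧ Orthonormal ℂ e ∧ u = ∑ l, e l ⊗ₜ[ℂ] z l := by
  obtain ⟨c, y, hy, hu⟩ := schmidtRank_spec u
  choose x t hx ht hxt using hy
  let X := Submodule.span ℂ (Set.range x)
  let e := stdOrthonormalBasis ℂ X
  have hxX : ∀ i, x i ∈ X := fun i => Submodule.subset_span ⟨i, rfl⟩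
  have he : ∀ i, x i = ∑ l, ⟪e l, (⟨x i, hxX i⟩ : X)⟫_ℂ • (e l : EuclideanSpace ℂ (Fin m)) := by
    intro i
    have := congrArg (Submodule.subtype X) (e.sum_repr' ⟨x i, hxX i⟩)
    simpa using this.symm
  refine ⟨Module.finrank ℂ X, fun l => e l, fun l => ∑ i, (c i * ⟪e l, (⟨x i, hxX i⟩ : X)⟫_ℂ) • t i,
    ?_, ?_, ?_⟩
  · exact (finrank_range_le_card (R := ℂ) x).trans (Fintype.card_fin _).le
  · exact e.orthonormal.comp_linearIsometry X.subtypeₗᵢ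
  · conv_lhs => rw [hu]
    simp_rw [TensorProduct.tmul_sum]
    rw [Finset.sum_comm]
    refine Finset.sum_congr rfl fun i _ => ?_
    rw [hxt i]
    conv_lhs => rw [he i]
    simp only [TensorProduct.sum_tmul, Finset.smul_sum, TensorProduct.tmul_smul, mul_smul,
      ← TensorProduct.smul_tmul']

/-- The squared overlap of a unit vector of Schmidt rank at most `k` with a vector is at most the
sum of the squares of the `k` largest Schmidt coefficients of the latter. -/
theorem norm_inner_sq_le {m n d k : ℕ} (hk : 1 ≤ k) (hkd : k ≤ d)
    {a : Fin d → EuclideanSpace ℂ (Fin m)} {b : Fin d → EuclideanSpace ℂ (Fin n)}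
    (ha : Orthonormal ℂ a) (hb : Orthonormal ℂ b) {β : Fin d → ℝ} (hβ : Antitone β)
    (hβ0 : ∀ i, 0 ≤ β i) {u : Bipartite m n} (hu : schmidtRank u ≤ k) :
    ‖⟪∑ i, (β i : ℂ) • (a i ⊗ₜ[ℂ] b i), u⟫_ℂ‖ ^ 2
      ≤ (∑ i with i.val < k, β i ^ 2) * ‖u‖ ^ 2 := by
  obtain ⟨s, e, z, hs, he, hz⟩ := exists_eq_sum_orthonormal_tmul u
  have hnorm : ‖u‖ ^ 2 = ∑ l, ‖z l‖ ^ 2 := by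
    apply Complex.ofReal_injective
    push_cast
    refine (inner_self_eq_norm_sq_to_K (𝕜 := ℂ) u).symm.trans ?_
    rw [hz, sum_inner]
    refine Finset.sum_congr rfl fun l _ => ?_
    rw [inner_sum]
    simp [TensorProduct.inner_tmul, orthonormal_iff_ite.1 he]
  have hin : ⟪∑ i, (β i : ℂ) • (a i ⊗ₜ[ℂ] b i), u⟫_ℂ
      = ∑ q : Fin d × Fin s, (β q.1 : ℂ) * ⟪a q.1, e q.2⟫_ℂ * ⟪b q.1, z q.2⟫_ℂ := by
    rw [hz, sum_inner, Fintype.sum_prod_type]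
    refine Finset.sum_congr rfl fun i _ => ?_
    rw [inner_sum]
    simp only [TensorProduct.smul_tmul', TensorProduct.inner_tmul, inner_smul_left,
      Complex.conj_ofReal]
  -- `p i` is the squared length of the projection of `a i` onto the span of `e`. Bessel for `e`
  -- bounds each by `1`; Bessel for `a` bounds their sum by `s ≤ k`.
  let p : Fin d → ℝ := fun i => ∑ l, ‖⟪a i, e l⟫_ℂ‖ ^ 2
  have hp1 : ∀ i, p i ≤ 1 := fun i => by
    have := he.sum_inner_products_le (a i) (s := Finset.univ)
    simpa [p, ha.1 i, norm_inner_symm (a i)] using this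
  have hp : ∑ i, p i ≤ k := by
    simp only [p]
    rw [Finset.sum_comm]
    calc ∑ l, ∑ i, ‖⟪a i, e l⟫_ℂ‖ ^ 2 ≤ ∑ l : Fin s, (1 : ℝ) :=
          Finset.sum_le_sum fun l _ => by
            simpa [he.1 l] using ha.sum_inner_products_le (e l) (s := Finset.univ)
      _ ≤ k := by simpa using hs.trans hu
  have h1 : ∑ q : Fin d × Fin s, (β q.1 * ‖⟪a q.1, e q.2⟫_ℂ‖) ^ 2
      ≤ ∑ i with i.val < k, β i ^ 2 := by
    refine le_trans (le_of_eq ?_) (sum_mul_le_sum_filter_lt hk hkd (f := fun i => β i ^ 2)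
      (fun i j h => pow_le_pow_left₀ (hβ0 j) (hβ h) 2) (fun i => sq_nonneg _)
      (fun i => Finset.sum_nonneg fun l _ => sq_nonneg _) hp1 hp)
    rw [Fintype.sum_prod_type]
    simp only [Finset.mul_sum, mul_pow]
  have h2 : ∑ q : Fin d × Fin s, ‖⟪b q.1, z q.2⟫_ℂ‖ ^ 2 ≤ ‖u‖ ^ 2 := by
    rw [hnorm, Fintype.sum_prod_type_right]
    exact Finset.sum_le_sum fun l _ => hb.sum_inner_products_le (z l)
  rw [hin]
  -- Cauchy–Schwarz over pairs, with `β` kept beside the overlaps of the first factor.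
  calc _ ≤ (∑ q : Fin d × Fin s, β q.1 * ‖⟪a q.1, e q.2⟫_ℂ‖ * ‖⟪b q.1, z q.2⟫_ℂ‖) ^ 2 := by
        refine pow_le_pow_left₀ (norm_nonneg _) ((norm_sum_le _ _).trans (le_of_eq ?_)) 2
        refine Finset.sum_congr rfl fun q _ => ?_
        simp [abs_of_nonneg (hβ0 q.1)]
    _ ≤ _ := Finset.sum_mul_sq_le_sq_mul_sq _ _ _
    _ ≤ _ := mul_le_mul h1 h2 (Finset.sum_nonneg fun _ _ => sq_nonneg _)
        (Finset.sum_nonneg fun _ _ => sq_nonneg _)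

/-! ### Duality and the value of the norm -/

/-- A vector `w` whose squared overlap with every unit vector of Schmidt rank at most `k` is at most
`M` yields a lower bound for `gammaNorm`. -/
theorem le_gammaNorm_ketbra_self {m n k : ℕ} {M : ℝ} (w v : Bipartite m n)
    (hw : ∀ u, ‖u‖ = 1 → schmidtRank u ≤ k → ‖⟪w, u⟫_ℂ‖ ^ 2 ≤ M) (hwv : ⟪w, v⟫_ℂ = (M : ℂ))
    (hne : ∃ (N : ℕ) (c : Fin N → ℂ) (x y : Fin N → Bipartite m n),
      (∀ i, ‖x i‖ = 1 ∧ schmidtRank (x i) ≤ k) ∧ (∀ i, ‖y i‖ = 1 ∧ schmidtRank (y i) ≤ k) ∧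
      ketbra v v = ∑ i, c i • ketbra (x i) (y i)) :
    M ≤ gammaNorm k (ketbra v v) := by
  obtain ⟨N, c, x, y, hx, hy, h⟩ := hne
  -- A real infimum over the empty set would be `0`, hence the need for some decomposition.
  refine le_csInf ⟨_, N, c, x, y, hx, hy, h, rfl⟩ ?_
  rintro _ ⟨N, c, x, y, hx, hy, h, rfl⟩
  rcases le_or_gt M 0 with hM | hM
  · exact hM.trans (Finset.sum_nonneg fun _ _ => norm_nonneg _)
  have h1 : ⟪w, ketbra v v w⟫_ℂ = (M : ℂ) * M := by
    rw [InnerProductSpace.inner_right_rankOne_apply, hwv, ← inner_conj_symm, hwv,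
      Complex.conj_ofReal]
  rw [h, inner_sum_rankOne_apply] at h1
  have h2 : ∀ i, ‖c i * (⟪w, x i⟫_ℂ * ⟪y i, w⟫_ℂ)‖ ≤ ‖c i‖ * M := fun i => by
    rw [norm_mul, norm_mul, norm_inner_symm (y i)]
    refine mul_le_mul_of_nonneg_left ?_ (norm_nonneg _)
    have h3 := hw _ (hx i).1 (hx i).2
    have h4 := hw _ (hy i).1 (hy i).2
    nlinarith [sq_nonneg (‖⟪w, x i⟫_ℂ‖ - ‖⟪w, y i⟫_ℂ‖)]
  have h3 : M * M ≤ (∑ i, ‖c i‖) * M := by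
    have h4 := congrArg norm h1
    rw [norm_mul, Complex.norm_real, Real.norm_of_nonneg hM.le] at h4
    rw [← h4, Finset.sum_mul]
    exact norm_sum_le_of_le _ fun i _ => h2 i
  exact le_of_mul_le_mul_right h3 hM

/-- `‖|v⟩⟨v|‖_{γ,k}` is computed from an antitone sequence `β` such that the Schmidt coefficients of
`v` are `β i * p i` with weights `p i ∈ [0, 1]` of total mass `k`. -/
theorem gammaNorm_ketbra_self_eq {m n d k : ℕ} (hk : 1 ≤ k) (hkd : k ≤ d) (hm : 0 < m) (hn : 0 < n)
    {a : Fin d → EuclideanSpace ℂ (Fin m)} {b : Fin d → EuclideanSpace ℂ (Fin n)}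
    (ha : Orthonormal ℂ a) (hb : Orthonormal ℂ b) {β p : Fin d → ℝ} (hβ : Antitone β)
    (hβ0 : ∀ i, 0 ≤ β i) (hp0 : ∀ i, 0 ≤ p i) (hp1 : ∀ i, p i ≤ 1) (hp : ∑ i, p i = k)
    {v : Bipartite m n} (hv : v = ∑ i, ((β i * p i : ℝ) : ℂ) • (a i ⊗ₜ[ℂ] b i))
    (hβp : ∑ i, β i ^ 2 * p i = ∑ i with i.val < k, β i ^ 2) :
    gammaNorm k (ketbra v v) = ∑ i with i.val < k, β i ^ 2 := by
  have hab := orthonormal_tmul ha hb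
  have hβsq : Antitone fun i => β i ^ 2 := fun i j h => pow_le_pow_left₀ (hβ0 j) (hβ h) 2
  have hsep : ∀ i, IsSeparable (a i ⊗ₜ[ℂ] b i) := fun i => ⟨a i, b i, ha.1 i, hb.1 i, rfl⟩
  let T : Finset (Fin d) := {i | i.val < k}
  have hT : #T = k := by simp [T, Fin.card_filter_val_lt, hkd]
  apply le_antisymm
  · obtain ⟨w, hw0, hw1, hw⟩ := exists_perm_weights T p hp0 hp1 (by rw [hp, hT])
    let S : Equiv.Perm (Fin d) → Finset (Fin d) := fun σ => {i | σ i ∈ T}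
    have hS : ∀ σ, #(S σ) = k := fun σ => by
      rw [← hT]
      exact Finset.card_bij (fun i _ => σ i) (by simp [S]) (fun i _ j _ h => σ.injective h)
        (fun j hj => ⟨σ.symm j, by simp [S, hj], by simp⟩)
    refine gammaNorm_ketbra_self_le hm hn hk w hw0 hw1
      (fun σ => ∑ i ∈ S σ, (β i : ℂ) • (a i ⊗ₜ[ℂ] b i)) (fun σ => ?_) (fun σ => ?_) ?_
    · exact (schmidtRank_sum_le (S σ) (fun i => (β i : ℂ)) _ hsep).trans (hS σ).le
    · refine (norm_sum_smul_sq hab (S σ) β).le.trans ?_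
      have := sum_mul_le_sum_filter_lt hk hkd (p := fun i => if i ∈ S σ then 1 else 0) hβsq
        (fun i => sq_nonneg _) (fun i => by split_ifs <;> norm_num)
        (fun i => by split_ifs <;> norm_num) (by simp [hS])
      simpa using this
    · rw [hv]
      simp only [S, Finset.sum_filter, Finset.smul_sum]
      rw [Finset.sum_comm]
      refine Finset.sum_congr rfl fun i _ => ?_
      rw [hw i, Finset.mul_sum, Complex.ofReal_sum, Finset.sum_smul]
      refine Finset.sum_congr rfl fun σ _ => ?_
      split_ifs
      · rw [smul_smul, mul_one, Complex.ofReal_mul, mul_comm]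
      · simp
  · refine le_gammaNorm_ketbra_self (∑ i, (β i : ℂ) • (a i ⊗ₜ[ℂ] b i)) v
      (fun u hu1 hu => ?_) ?_ ?_
    · simpa [hu1] using norm_inner_sq_le hk hkd ha hb hβ hβ0 hu
    · rw [hv, ← hβp]
      refine (hab.inner_sum (fun i => (β i : ℂ)) (fun i => ((β i * p i : ℝ) : ℂ)) _).trans ?_
      rw [Complex.ofReal_sum]
      refine Finset.sum_congr rfl fun i _ => ?_
      rw [Complex.conj_ofReal]
      push_cast
      ring
    -- Expansion in product vectors, used only to show that a decomposition exists.
    · let c : Fin d → ℝ := fun i => β i * p i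
      let e := (Fintype.equivFin (Fin d × Fin d)).symm
      have hrank : ∀ i, ‖a i ⊗ₜ[ℂ] b i‖ = 1 ∧ schmidtRank (a i ⊗ₜ[ℂ] b i) ≤ k := fun i => by
        refine ⟨hab.1 i, le_trans ?_ hk⟩
        simpa using schmidtRank_sum_le {i} (fun _ => 1) _ hsep
      refine ⟨_, fun j => ((c (e j).1 * c (e j).2 : ℝ) : ℂ), fun j => a (e j).1 ⊗ₜ[ℂ] b (e j).1,
        fun j => a (e j).2 ⊗ₜ[ℂ] b (e j).2, fun j => hrank _, fun j => hrank _, ?_⟩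
      rw [e.sum_comp fun q => ((c q.1 * c q.2 : ℝ) : ℂ) •
        ketbra (a q.1 ⊗ₜ[ℂ] b q.1) (a q.2 ⊗ₜ[ℂ] b q.2), hv]
      exact rankOne_sum_smul_self c fun i => a i ⊗ₜ[ℂ] b i

/-! ### The cut index -/

theorem cutIndex_lt {d k : ℕ} (hk : 1 ≤ k) (α : ℕ → ℝ) : cutIndex d k α < k := by
  rcases Set.eq_empty_or_nonempty {r : ℕ | 1 ≤ r ∧ r < k ∧ tailMean d k α r < α r} with h | h
  · rw [cutIndex, h]
    rwa [csSup_empty]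
  · exact (Nat.sSup_mem h ⟨k, fun r hr => hr.2.1.le⟩).2.1

theorem tailMean_cutIndex_lt {d k : ℕ} (α : ℕ → ℝ) (h0 : 1 ≤ cutIndex d k α) :
    tailMean d k α (cutIndex d k α) < α (cutIndex d k α) := by
  rcases Set.eq_empty_or_nonempty {r : ℕ | 1 ≤ r ∧ r < k ∧ tailMean d k α r < α r} with h | h
  · rw [cutIndex, h] at h0
    simp at h0
  · exact (Nat.sSup_mem h ⟨k, fun r hr => hr.2.1.le⟩).2.2

/-- If `r + 1 < k`, maximality of `r` makes the defining inequality fail at `r + 1`; clearing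
denominators and adding `α (r + 1)` turns that failure into the claim. If `r + 1 = k`, the
denominator is `1` and the remaining terms are nonnegative. -/
theorem le_tailMean_cutIndex {d k : ℕ} (hk : 1 ≤ k) (hkd : k ≤ d) {α : ℕ → ℝ}
    (hα : ∀ i ∈ Set.Icc 1 d, 0 ≤ α i) :
    α (cutIndex d k α + 1) ≤ tailMean d k α (cutIndex d k α) := by
  have hlt := cutIndex_lt (d := d) hk α
  set r := cutIndex d k α with hr
  have hsum : ∑ i ∈ Icc (r + 1) d, α i = α (r + 1) + ∑ i ∈ Icc (r + 1 + 1) d, α i := by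
    rw [← Finset.insert_Icc_add_one_left_eq_Icc (by omega), Finset.sum_insert (by simp)]
  have hkr : (0 : ℝ) < k - r := sub_pos.2 (by exact_mod_cast hlt)
  rw [tailMean, le_div_iff₀ hkr, hsum]
  rcases Nat.lt_or_ge (r + 1) k with h | h
  · have hn : ¬ tailMean d k α (r + 1) < α (r + 1) := fun hn => by
      have : r + 1 ≤ cutIndex d k α := le_csSup
        (s := {r : ℕ | 1 ≤ r ∧ r < k ∧ tailMean d k α r < α r})
        ⟨k, fun r hr => hr.2.1.le⟩ ⟨by omega, h, hn⟩
      omega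
    have hkr' : (0 : ℝ) < k - (r + 1 : ℕ) := sub_pos.2 (by exact_mod_cast h)
    rw [not_lt, tailMean, le_div_iff₀ hkr'] at hn
    push_cast at hn
    linarith
  · have hk' : k = r + 1 := by omega
    have h1 : 0 ≤ ∑ i ∈ Icc (r + 1 + 1) d, α i :=
      Finset.sum_nonneg fun i hi => hα i (by simp at hi ⊢; omega)
    have h2 : (k : ℝ) - r = 1 := by rw [hk']; push_cast; ring
    rw [h2]
    linarith

theorem sum_fin_filter_lt {d r : ℕ} (hr : r ≤ d) (f : ℕ → ℝ) :
    ∑ i : Fin d with i.val < r, f (i + 1) = ∑ i ∈ Icc 1 r, f i := by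
  refine Finset.sum_bij (fun i _ => i.val + 1) (fun i hi => by simp at hi ⊢; omega)
    (fun i _ j _ h => Fin.ext (by simpa using h))
    (fun i hi => ?_) (fun i _ => rfl)
  rw [Finset.mem_Icc] at hi
  exact ⟨⟨i - 1, by omega⟩, by simp; omega, by simp; omega⟩

theorem sum_fin_filter_not_lt {d r : ℕ} (f : ℕ → ℝ) :
    ∑ i : Fin d with ¬ i.val < r, f (i + 1) = ∑ i ∈ Icc (r + 1) d, f i := by
  refine Finset.sum_bij (fun i _ => i.val + 1) (fun i hi => by simp at hi ⊢; omega)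
    (fun i _ j _ h => Fin.ext (by simpa using h))
    (fun i hi => ?_) (fun i _ => rfl)
  rw [Finset.mem_Icc] at hi
  exact ⟨⟨i - 1, by omega⟩, by simp; omega, by simp; omega⟩

end EntanglementNorm

/-! ### The theorem -/

open EntanglementNorm Finset

theorem theorem5p1 {m n k : ℕ} (hk : 1 ≤ k) (hkmn : k ≤ min m n)
    (v : EntanglementNorm.Bipartite m n) (hv : ‖v‖ = 1)
    (α : ℕ → ℝ) (hα : EntanglementNorm.IsSchmidtCoefficients v α)
    (r : ℕ) (hr : r = EntanglementNorm.cutIndex (min m n) k α)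
    (αt : ℝ) (hαt : αt = EntanglementNorm.tailMean (min m n) k α r) :
    EntanglementNorm.gammaNorm k (EntanglementNorm.ketbra v v) =
      ∑ i ∈ Finset.Icc 1 r, α i ^ 2 + ((k : ℝ) - (r : ℝ)) * αt ^ 2 := by
  obtain ⟨hanti, hpos, a, b, ha, hb, hvab⟩ := hα
  have hm : 0 < m := by omega
  have hn : 0 < n := by omega
  have hrk : r < k := hr ▸ cutIndex_lt hk α
  have hle : α (r + 1) ≤ αt := by
    rw [hαt, hr]
    exact le_tailMean_cutIndex hk hkmn hpos
  have hlt : 1 ≤ r → αt < α r := fun h => by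
    rw [hαt, hr]
    exact tailMean_cutIndex_lt α (hr ▸ h)
  have hkr : (0 : ℝ) < k - r := sub_pos.2 (by exact_mod_cast hrk)
  have htail : ∑ i ∈ Icc (r + 1) (min m n), α i = (k - r) * αt := by
    rw [hαt, tailMean, mul_div_cancel₀ _ hkr.ne']
  have hαt0 : 0 ≤ αt := (hpos (r + 1) ⟨by omega, by omega⟩).trans hle
  have htl : ∀ i : Fin (min m n), ¬ i.val < r → α (i + 1) ≤ αt := fun i hi =>
    (hanti ⟨by omega, by omega⟩ ⟨by omega, by omega⟩ (by omega)).trans hle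
  have hfin0 : ∀ i : Fin (min m n), 0 ≤ α (i + 1) := fun i => hpos _ ⟨by omega, by omega⟩
  let β : Fin (min m n) → ℝ := fun i => if i.val < r then α (i + 1) else αt
  have hβ : Antitone β := by
    intro i j hij
    have hij' : i.val ≤ j.val := hij
    by_cases hj : j.val < r
    · have hi : i.val < r := by omega
      simp only [β, hi, hj, if_true]
      exact hanti ⟨by omega, by omega⟩ ⟨by omega, by omega⟩ (by omega)
    · by_cases hi : i.val < r
      · simp only [β, hi, hj, if_true, if_false]
        exact (hlt (by omega)).le.trans
          (hanti ⟨by omega, by omega⟩ ⟨by omega, by omega⟩ (by omega))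
      · simp [β, hi, hj]
  have hβ0 : ∀ i, 0 ≤ β i := fun i => by
    simp only [β]
    split_ifs
    exacts [hfin0 i, hαt0]
  have hhead : ∑ i : Fin (min m n) with i.val < r, β i ^ 2 = ∑ i ∈ Icc 1 r, α i ^ 2 := by
    rw [← sum_fin_filter_lt (d := min m n) (by omega) fun i => α i ^ 2]
    refine Finset.sum_congr rfl fun i hi => ?_
    simp only [β, if_pos (Finset.mem_filter.1 hi).2]
  have hcard : ∀ j ≤ min m n, (∑ i : Fin (min m n), if i.val < j then (1 : ℝ) else 0) = j := fun j hj => by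
    simp [Finset.sum_boole, Fin.card_filter_val_lt, hj]
  have hval : ∑ i : Fin (min m n) with i.val < k, β i ^ 2 = ∑ i ∈ Icc 1 r, α i ^ 2 + (k - r) * αt ^ 2 := by
    rw [← hhead, Finset.sum_filter, Finset.sum_filter, ← hcard k hkmn, ← hcard r (by omega),
      ← Finset.sum_sub_distrib, Finset.sum_mul, ← Finset.sum_add_distrib]
    refine Finset.sum_congr rfl fun i _ => ?_
    by_cases hi : i.val < r
    · simp [β, hi, hi.trans hrk]
    · simp [β, hi]
  obtain ⟨p, hp0, hp1, hp, hβp⟩ : ∃ p : Fin (min m n) → ℝ, (∀ i, 0 ≤ p i) ∧ (∀ i, p i ≤ 1) ∧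
      ∑ i, p i = k ∧ ∀ i, β i * p i = α (i + 1) := by
    -- If `αt = 0`, both `α` and `β` vanish past `r`, so any tail weights of the right mass work.
    -- Otherwise the tail weights must be `α (i + 1) / αt`, of total mass `k - r`.
    rcases hαt0.eq_or_lt with h0 | h0
    · refine ⟨fun i => if i.val < k then 1 else 0, fun i => by dsimp only; split_ifs <;> norm_num,
        fun i => by dsimp only; split_ifs <;> norm_num, hcard k hkmn, fun i => ?_⟩
      by_cases hi : i.val < r
      · simp [β, hi, hi.trans hrk]
      · have : α (i + 1) = 0 := le_antisymm (h0 ▸ htl i hi) (hfin0 i)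
        simp [β, hi, ← h0, this]
    · refine ⟨fun i => if i.val < r then 1 else α (i + 1) / αt, fun i => ?_, fun i => ?_, ?_,
        fun i => ?_⟩
      · have := hfin0 i
        dsimp only
        split_ifs <;> positivity
      · dsimp only
        split_ifs with hi
        · exact le_rfl
        · exact (div_le_one h0).2 (htl i hi)
      · rw [Finset.sum_ite, Finset.sum_const, ← Finset.sum_div, sum_fin_filter_not_lt, htail,
          mul_div_cancel_right₀ _ h0.ne', Fin.card_filter_val_lt, min_eq_right (by omega)]
        simp
      · by_cases hi : i.val < r
        · simp [β, hi]
        · simp only [β, hi, if_false]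
          field_simp
  rw [← hval]
  refine gammaNorm_ketbra_self_eq hk hkmn hm hn ha hb hβ hβ0 hp0 hp1 hp (by simpa only [hβp]) ?_
  -- Since `β * p = α`, the head gives `∑ α i ^ 2` and the tail gives `αt` times the tail sum, that
  -- is `(k - r) * αt ^ 2`.
  rw [hval, ← hhead, ← Finset.sum_filter_add_sum_filter_not Finset.univ fun i : Fin (min m n) => i.val < r]
  congr 1
  · refine Finset.sum_congr rfl fun i hi => ?_
    rw [sq, mul_assoc, hβp]
    simp only [β, if_pos (Finset.mem_filter.1 hi).2]
  · rw [sq, ← mul_assoc, ← htail, ← sum_fin_filter_not_lt, Finset.sum_mul]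
    refine Finset.sum_congr rfl fun i hi => ?_
    rw [sq, mul_assoc, hβp, mul_comm]
    simp only [β, if_neg (Finset.mem_filter.1 hi).2]
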